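/- An oriented graph is a directed graph without loops in which any two vertices are joined by at most one edge (in one of the two directions). The Euler genus of a closed surface $S$ is $2-n+e-f$ for any graph with $n$ vertices and $e$ edges that has a $2$-cell embedding in $S$ with $f$ faces; the Euler genus of a finite graph is the least Euler genus of a surface in which it embeds, and the Euler genus of an oriented graph is that of its underlying simple graph. An oriented homomorphism from $G$ to $H$ is a map $\phi:V(G)\to V(H)$ such that $(\phi(u),\phi(v))$ is an edge of $H$ for every edge $(u,v)$ of $G$. Let $K$ be an oriented $k$-partite graph with partite sets $P_1,\dots,P_k$, each of exactly $N$ vertices. $K$ is $(k,d,N)$-full if for every $i\in\{1,\dots,k\}$, every sequence $u_1,\dots,u_t$ of $t\le d$ distinct vertices in $\bigcup_{j\ne i}P_j$ and every $(s_1,\dots,s_t)\in\{-1,1\}^t$ there is a vertex $x\in P_i$ such that, for each $j\in\{1,\dots,t\}$, $(x,u_j)$ is an edge of $K$ if $s_j=1$ and $(u_j,x)$ is an edge of $K$ if $s_j=-1$. **Theorem 4.1.** Let $g\ge 2$ be an integer, let $N$ be a non-negative integer, let $K$ be a $(144g-162,10,N)$-full oriented graph with partite sets $P_1,\dots,P_{144g-162}$,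 and let $H_g$ be the oriented graph obtained from $K$ by deleting every edge that has both ends in $P_{138g-161}\cup\dots\cup P_{144g-162}$ (the last $6g$ partite sets). Then for every finite oriented graph $G$ of Euler genus at most $g$ there is an oriented graph $H$ that contains $H_g$ as a spanning subgraph such that $G$ has an oriented homomorphism to $H$. -/

import Mathlib

/-- An oriented graph: a directed graph without loops and with at most one edge (in one of the two
directions) between any two vertices. Asymmetry also excludes loops. -/
structure OrientedGraph (V : Type*) extends Digraph V where
  asymm : ∀ u v, Adj u v → ¬ Adj v u

namespace OrientedGraph

variable {V W : Type*}

/-- The underlying simple graph. -/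
def underlying (G : OrientedGraph V) : SimpleGraph V where
  Adj u v := G.Adj u v ∨ G.Adj v u
  symm := ⟨fun _ _ h => h.symm⟩
  loopless := ⟨fun u h => h.elim (fun h => G.asymm u u h h) (fun h => G.asymm u u h h)⟩

/-- `φ` is an oriented homomorphism from `G` to `H`. -/
def IsHom (G : OrientedGraph V) (H : OrientedGraph W) (φ : V → W) : Prop :=
  ∀ u v, G.Adj u v → H.Adj (φ u) (φ v)

/-- `H'` is a spanning subgraph of `H`: same vertex set, and every edge of `H'` is one of `H`. -/
def IsSpanningSubgraph (H' H : OrientedGraph W) : Prop :=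
  ∀ u v, H'.Adj u v → H.Adj u v

/-- `F(U, x, H) = s`, for an ordered vertex set `U = (u 0, …, u (t-1))`: all its members are
neighbours of `x`, with `x → u j` where `s j = 1` and `u j → x` where `s j = -1`. -/
def HasPattern (H : OrientedGraph W) {t : ℕ} (u : Fin t ↪ W) (x : W) (s : Fin t → ℤˣ) : Prop :=
  ∀ j, (s j = 1 → H.Adj x (u j)) ∧ (s j = -1 → H.Adj (u j) x)

/-- `H`, with its partite sets given as the fibres `P i = part ⁻¹' {i}`, is `(k, d, N)`-full. -/
structure IsFull (H : OrientedGraph W) (k d N : ℕ) (part : W → Fin k) : Prop where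
  /-- `H` is `k`-partite with the given partite sets. -/
  partite : ∀ u v, H.Adj u v → part u ≠ part v
  /-- Every partite set has exactly `N` vertices (in particular it is finite). -/
  card_part : ∀ i, (part ⁻¹' {i}).encard = N
  /-- Every sign pattern on at most `d` vertices outside `P i` is realised by a vertex of `P i`. -/
  full : ∀ (i : Fin k) (t : ℕ), t ≤ d → ∀ u : Fin t ↪ W, (∀ j, part (u j) ≠ i) →
    ∀ s : Fin t → ℤˣ, ∃ x, part x = i ∧ H.HasPattern u x s

/-- Delete all edges of `K` that have both ends in the last `m` of the `k` sets
`P i = part ⁻¹' {i}`, i.e. in those with `k - m ≤ i < k` (indices start at `0`). -/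
def deleteEdgesInLast (K : OrientedGraph W) {k : ℕ} (part : W → Fin k) (m : ℕ) :
    OrientedGraph W where
  Adj u v := K.Adj u v ∧ ¬ (k ≤ (part u : ℕ) + m ∧ k ≤ (part v : ℕ) + m)
  asymm u v h h' := K.asymm u v h.1 h'.1

end OrientedGraph

namespace SimpleGraph

variable {V : Type*}

/-- The flags of a graph. The flag `(a, s)` stands for the end of the edge `a.edge` at the vertex
`a.fst`, seen from one of the two sides (named by `s`) of that edge. -/
abbrev Flag (G : SimpleGraph V) : Type _ := G.Dart × Bool

/-- Cross the edge: same edge, same end, other side. -/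
def Flag.cross {G : SimpleGraph V} (x : G.Flag) : G.Flag := (x.1, !x.2)

/-- Move along the edge: same edge, same side, other end. -/
def Flag.along {G : SimpleGraph V} (x : G.Flag) : G.Flag := (x.1.symm, x.2)

/-- A cellular embedding of a finite graph `G` in closed surfaces, one connected surface for each
connected component, orientable or not, in its usual combinatorial form (a map given by its flags
and three involutions on them; the same data as a rotation system with edge signatures, up to
renaming of local orientations). Two involutions, `cross` and `along`, are determined by the graph.
The third one, `turn`, sends a flag to the other flag of the same corner: same vertex, same face at
that vertex, next edge. At each non-isolated vertex, the edge ends have to be arranged in one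
cyclic order: one reaches every flag there from every other one by crossing edges and corners. -/
structure CellularEmbedding (G : SimpleGraph V) where
  /-- The other flag of the same corner. -/
  turn : G.Flag → G.Flag
  turn_turn : ∀ x, turn (turn x) = x
  turn_ne : ∀ x, turn x ≠ x
  turn_fst : ∀ x, (turn x).1.fst = x.1.fst
  rotation : ∀ x y : G.Flag, x.1.fst = y.1.fst →
    Relation.ReflTransGen (fun a b => b = turn a ∨ b = a.cross) x y

namespace CellularEmbedding

variable {G : SimpleGraph V}

/-- The facial walks of an embedding: the classes of flags under walking along edges and turning at
corners. -/
def FacialWalk (M : G.CellularEmbedding) : Type _ :=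
  Quot (fun a b : G.Flag => b = M.turn a ∨ b = a.along)

/-- The number of faces. A component that is an isolated vertex lies on a sphere with exactly one
face; it has no flags, so these faces are counted separately. -/
noncomputable def numFaces (M : G.CellularEmbedding) : ℕ :=
  Nat.card M.FacialWalk + Nat.card {v : V // ∀ w, ¬ G.Adj v w}

/-- The sum, over the connected components of `G`, of the Euler genera `2 - n + e - f` of the
surfaces in which they are embedded. For connected `G` this is `2 - n + e - f`; in general it is
the Euler genus of the connected sum of these surfaces, which contains a copy of `G`. -/
noncomputable def eulerGenus (M : G.CellularEmbedding) : ℤ :=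
  2 * (Nat.card G.ConnectedComponent : ℤ) - Nat.card V + Nat.card G.edgeSet - M.numFaces

end CellularEmbedding

/-- The Euler genus of a finite graph: the least Euler genus over its embeddings. (`M.eulerGenus` is
never negative, and every finite graph has some `M`; were there none, the value would be `⊤`.) -/
noncomputable def eulerGenus (G : SimpleGraph V) : ℕ∞ :=
  ⨅ M : G.CellularEmbedding, (M.eulerGenus.toNat : ℕ∞)

theorem eulerGenus_le_iff (G : SimpleGraph V) (g : ℕ) :
    G.eulerGenus ≤ g ↔ ∃ M : G.CellularEmbedding, M.eulerGenus ≤ g := by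
  constructor
  · intro h
    rcases isEmpty_or_nonempty G.CellularEmbedding with hE | hE
    · simp [eulerGenus] at h
    · obtain ⟨M, hM⟩ := ENat.exists_eq_iInf
        (fun M : G.CellularEmbedding => (M.eulerGenus.toNat : ℕ∞))
      refine ⟨M, ?_⟩
      rw [eulerGenus, ← hM] at h
      have : M.eulerGenus.toNat ≤ g := by exact_mod_cast h
      omega
  · rintro ⟨M, hM⟩
    refine (iInf_le _ M).trans ?_
    have : M.eulerGenus.toNat ≤ g := by omega
    exact_mod_cast this

end SimpleGraph

/-!
Vertices of `G` are coloured greedily. Remove vertices from `G` one at a time as long as more than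
`6 g` remain, and colour them in reverse order of removal; the vertices left at the end are
coloured first, and go to different sets among the last `6 g` partite sets, inside which `H` may have
any edges. If `L` is the set of vertices present when `v` is removed, then `v` needs at most `10`
neighbours in `L`, mapped to different partite sets, so that fullness provides an image of `v`. To
have this for all vertices, the partite set of `v` is chosen to avoid those of the vertices of `L`
that are adjacent to `v` or share a neighbour outside `L` with it (the reach of `v`, `reachIn`). As
`138 g - 162` partite sets are available, it suffices that the reach has fewer vertices than that
(`IsPartialHom.extend`).

A suitable `v` exists by counting (`exists_card_nbrsIn_le_card_reachIn_lt`). The average degree in `L`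
is less than `7`, which is all that is needed when `L` itself is small. When `L` is large, the
average size of the reach is at most about `36` (`sum_card_reachIn_le`), since three subgraphs are sparse:
the one induced on `L`, the bipartite graph between `L` and the outer vertices with at least three
neighbours in `L`, and the one formed by outer vertices with exactly two, where each pair of
neighbours is taken once.

All three bounds are instances of Euler's inequality `(s - 2) e ≤ s (n + g - 2)` for a subgraph
without cycles shorter than `s`, with `s = 3, 4, 6` (`card_edges_le`). This is proved for a subgraph
of an embedded graph by linear algebra over `𝔽₂`, without embedding the subgraph. The face boundaries
have codimension at most the Euler genus in the cycle space (`finrank_cycleSpace_le`), hence so do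
the boundaries supported in a set `S` of edges in the cycle space of `S`, which has dimension at least
`|S| - n + 1`. These boundaries are spanned by the boundaries of the regions into which `S` divides
the surface. The nonzero ones among these sum to zero, have at least `s` edges each, and cover each
edge of `S` at most twice.
-/

open scoped Classical

/-! ### The mod 2 cycle space of a graph -/

namespace SimpleGraph

variable {V : Type*} {G : SimpleGraph V}

section

variable [Fintype V]

/-- The vertex-edge incidence matrix of `G` over `𝔽₂`. -/
noncomputable def incidence (G : SimpleGraph V) : Matrix V G.edgeSet (ZMod 2) :=
  fun v e => if v ∈ e.1 then 1 else 0

/-- The cycle space of `G` over `𝔽₂`: the edge vectors that have even degree at every vertex. -/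
noncomputable def cycleSpace (G : SimpleGraph V) : Submodule (ZMod 2) (G.edgeSet → ZMod 2) :=
  LinearMap.ker G.incidence.mulVecLin

theorem mem_cycleSpace {z : G.edgeSet → ZMod 2} :
    z ∈ G.cycleSpace ↔ ∀ v, ∑ e, (if v ∈ e.1 then z e else 0) = 0 := by
  simp [cycleSpace, incidence, funext_iff, Matrix.mulVec, dotProduct]

theorem incidence_transpose_mulVec (f : V → ZMod 2) {u v : V} (h : G.Adj u v) :
    (G.incidence.transpose.mulVec f) ⟨s(u, v), h⟩ = f u + f v := by
  have : ∀ x, (if x ∈ s(u, v) then f x else 0) = (if x ∈ ({u, v} : Finset V) then f x else 0) := by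
    intro x; simp
  simp only [Matrix.mulVec, dotProduct, incidence, Matrix.transpose_apply, ite_mul, one_mul,
    zero_mul, this]
  rw [Finset.sum_ite_mem, Finset.univ_inter, Finset.sum_pair h.ne]

/-- A function on the vertices with zero coboundary is constant on the connected components. -/
theorem finrank_ker_incidence_transpose_le (G : SimpleGraph V) :
    Module.finrank (ZMod 2) (LinearMap.ker G.incidence.transpose.mulVecLin)
      ≤ Nat.card G.ConnectedComponent := by
  let ev : LinearMap.ker G.incidence.transpose.mulVecLin →ₗ[ZMod 2]
      (G.ConnectedComponent → ZMod 2) :=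
    (LinearMap.pi fun C => LinearMap.proj C.out).comp (Submodule.subtype _)
  have hev : Function.Injective ev := by
    rw [injective_iff_map_eq_zero]
    rintro ⟨f, hf⟩ h0
    have hadj : ∀ u v, G.Adj u v → f u = f v := by
      intro u v h
      have h1 := congrFun (LinearMap.mem_ker.1 hf) ⟨s(u, v), h⟩
      rw [Matrix.mulVecLin_apply, incidence_transpose_mulVec f h] at h1
      exact CharTwo.add_eq_zero.1 h1
    have hreach : ∀ u v, G.Reachable u v → f u = f v := by
      rintro u v ⟨p⟩
      induction p with
      | nil => rfl
      | cons h _ ih => rw [hadj _ _ h, ih]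
    ext v
    have h1 := congrFun h0 (G.connectedComponentMk v)
    have h2 : G.Reachable (G.connectedComponentMk v).out v :=
      ConnectedComponent.exact (Quot.out_eq _)
    exact (hreach _ _ h2).symm.trans h1
  have := LinearMap.finrank_le_finrank_of_injective hev
  rwa [Module.finrank_fintype_fun_eq_card, ← Nat.card_eq_fintype_card] at this

theorem finrank_cycleSpace_add_le (G : SimpleGraph V) :
    Module.finrank (ZMod 2) G.cycleSpace + Nat.card V
      ≤ Nat.card G.edgeSet + Nat.card G.ConnectedComponent := by
  have h1 := G.incidence.mulVecLin.finrank_range_add_finrank_ker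
  have h2 := G.incidence.transpose.mulVecLin.finrank_range_add_finrank_ker
  have h3 := G.finrank_ker_incidence_transpose_le
  have h4 := G.incidence.rank_transpose
  rw [Matrix.rank, Matrix.rank] at h4
  rw [Module.finrank_fintype_fun_eq_card, ← Nat.card_eq_fintype_card] at h1 h2
  unfold cycleSpace
  omega

end

/-! ### Boundaries of faces -/

theorem exists_dart_edge_eq (e : G.edgeSet) : ∃ d : G.Dart, d.edge = e.1 := by
  obtain ⟨e, he⟩ := e
  induction e with
  | h u v => exact ⟨⟨(u, v), he⟩, rfl⟩

/-- One of the two darts of an edge. -/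
noncomputable def edgeDart (e : G.edgeSet) : G.Dart := (exists_dart_edge_eq e).choose

theorem edgeDart_edge (e : G.edgeSet) : (edgeDart e).edge = e.1 :=
  (exists_dart_edge_eq e).choose_spec

namespace CellularEmbedding

variable (M : G.CellularEmbedding)

/-- The face on which a flag lies. -/
def face (x : G.Flag) : M.FacialWalk := Quot.mk _ x

theorem face_turn (x : G.Flag) : M.face (M.turn x) = M.face x :=
  (Quot.sound (r := fun a b : G.Flag => b = M.turn a ∨ b = a.along) (Or.inl rfl)).symm

theorem face_symm (d : G.Dart) (b : Bool) : M.face (d.symm, b) = M.face (d, b) :=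
  (Quot.sound (r := fun a b : G.Flag => b = M.turn a ∨ b = a.along)
    (a := (d, b)) (Or.inr rfl)).symm

/-- The boundary, over `𝔽₂`, of a set of faces: an edge counts once for each of its two sides. -/
noncomputable def boundary : (M.FacialWalk → ZMod 2) →ₗ[ZMod 2] (G.edgeSet → ZMod 2) where
  toFun c e := c (M.face (edgeDart e, true)) + c (M.face (edgeDart e, false))
  map_add' c c' := by ext e; simp only [Pi.add_apply]; ring
  map_smul' a c := by ext e; simp only [Pi.smul_apply, smul_eq_mul, RingHom.id_apply]; ring

theorem boundary_apply (c : M.FacialWalk → ZMod 2) (e : G.edgeSet) :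
    M.boundary c e = c (M.face (edgeDart e, true)) + c (M.face (edgeDart e, false)) := rfl

theorem boundary_apply_of_edge_eq (c : M.FacialWalk → ZMod 2) {e : G.edgeSet} {d : G.Dart}
    (h : d.edge = e.1) :
    M.boundary c e = c (M.face (d, true)) + c (M.face (d, false)) := by
  rw [boundary_apply]
  rcases (dart_edge_eq_iff _ _).1 ((edgeDart_edge e).trans h.symm) with h | h
  · rw [h]
  · rw [h, face_symm, face_symm]

noncomputable instance [Finite V] : Fintype M.FacialWalk :=
  have : Fintype V := Fintype.ofFinite V
  have : Finite M.FacialWalk := inferInstanceAs (Finite (Quot _))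
  Fintype.ofFinite _

variable [Fintype V]

/-- Facial walks are closed: the turns at the corners pair off the flags of a face at a vertex. -/
theorem boundary_mem_cycleSpace (c : M.FacialWalk → ZMod 2) : M.boundary c ∈ G.cycleSpace := by
  rw [mem_cycleSpace]
  intro v
  have hflag : ∑ x : G.Flag, (if x.1.fst = v then c (M.face x) else 0) = 0 := by
    refine Finset.sum_involution (fun x _ => M.turn x) ?_ ?_ (by simp) ?_
    · intro x _
      rw [M.turn_fst, M.face_turn]
      exact CharTwo.add_self_eq_zero _
    · intro x _ _
      exact M.turn_ne x
    · intro x _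
      exact M.turn_turn x
  rw [Fintype.sum_prod_type] at hflag
  rw [← Finset.sum_fiberwise (s := Finset.univ)
    (g := fun d : G.Dart => (⟨d.edge, d.edge_mem⟩ : G.edgeSet))] at hflag
  refine Eq.trans ?_ hflag
  refine Finset.sum_congr rfl fun e _ => ?_
  have hfib : (Finset.univ.filter fun d : G.Dart => (⟨d.edge, d.edge_mem⟩ : G.edgeSet) = e)
      = {edgeDart e, (edgeDart e).symm} := by
    ext d
    simp only [Finset.mem_filter, Finset.mem_univ, true_and, Finset.mem_insert,
      Finset.mem_singleton, Subtype.ext_iff]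
    rw [← edgeDart_edge e, dart_edge_eq_iff]
  rw [hfib, Finset.sum_pair (edgeDart e).symm_ne.symm]
  simp only [Fintype.sum_bool, face_symm]
  have hv : v ∈ e.1 ↔ (edgeDart e).fst = v ∨ (edgeDart e).snd = v := by
    rw [← edgeDart_edge e, Dart.edge]
    simp [eq_comm]
  have hne := (edgeDart e).adj.ne
  have hs : (edgeDart e).symm.fst = (edgeDart e).snd := rfl
  rw [boundary_apply, hs]
  by_cases h1 : (edgeDart e).fst = v <;> by_cases h2 : (edgeDart e).snd = v
  · exact absurd (h1.trans h2.symm) hne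
  all_goals simp [hv, h1, h2]

/-- A face containing a given vertex, where an isolated vertex is its own face. -/
noncomputable def faceAt (v : V) : M.FacialWalk ⊕ {v : V // ∀ w, ¬ G.Adj v w} :=
  if h : ∀ w, ¬ G.Adj v w then Sum.inr ⟨v, h⟩
  else Sum.inl (M.face (⟨(v, (not_forall_not.1 h).choose), (not_forall_not.1 h).choose_spec⟩, true))

/-- A set of faces with zero boundary is constant on each component: crossing edges and turning at
corners leads around each vertex, and moving along edges leads from vertex to vertex. Hence the only
relations between face boundaries are the sums over components. -/
theorem numFaces_le_finrank_range_boundary :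
    M.numFaces ≤ Module.finrank (ZMod 2) (LinearMap.range M.boundary)
      + Nat.card G.ConnectedComponent := by
  let A := M.FacialWalk ⊕ {v : V // ∀ w, ¬ G.Adj v w} → ZMod 2
  let r : A →ₗ[ZMod 2] (M.FacialWalk → ZMod 2) := LinearMap.funLeft _ _ Sum.inl
  let B : A →ₗ[ZMod 2] (G.edgeSet → ZMod 2) := M.boundary ∘ₗ r
  have hr : Function.Surjective r := LinearMap.funLeft_surjective_of_injective _ _ _ Sum.inl_injective
  have hrange : LinearMap.range B = LinearMap.range M.boundary :=
    LinearMap.range_comp_of_range_eq_top _ (LinearMap.range_eq_top.2 hr)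
  let ev : LinearMap.ker B →ₗ[ZMod 2] (G.ConnectedComponent → ZMod 2) :=
    (LinearMap.pi fun C => LinearMap.proj (M.faceAt C.out)).comp (Submodule.subtype _)
  have hev : Function.Injective ev := by
    rw [injective_iff_map_eq_zero]
    rintro ⟨c, hc⟩ h0
    have hcross : ∀ x : G.Flag, c (Sum.inl (M.face x.cross)) = c (Sum.inl (M.face x)) := by
      rintro ⟨d, b⟩
      have h1 := congrFun (LinearMap.mem_ker.1 hc) ⟨d.edge, d.edge_mem⟩
      have h2 : M.boundary (r c) ⟨d.edge, d.edge_mem⟩ = 0 := h1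
      rw [M.boundary_apply_of_edge_eq (r c) (d := d) rfl] at h2
      have h3 : c (Sum.inl (M.face (d, true))) = c (Sum.inl (M.face (d, false))) :=
        CharTwo.add_eq_zero.1 h2
      cases b
      · exact h3
      · exact h3.symm
    have hrot : ∀ x y : G.Flag, x.1.fst = y.1.fst →
        c (Sum.inl (M.face x)) = c (Sum.inl (M.face y)) := by
      intro x y h
      have hxy := M.rotation x y h
      clear h
      induction hxy with
      | refl => rfl
      | tail _ hbc ih =>
        rcases hbc with h | h
        · rw [ih, h, M.face_turn]
        · rw [ih, h, hcross]
    have hat : ∀ x : G.Flag, c (Sum.inl (M.face x)) = c (M.faceAt x.1.fst) := by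
      intro x
      have hn : ¬ ∀ w, ¬ G.Adj x.1.fst w := fun h => h _ x.1.adj
      rw [faceAt, dif_neg hn]
      exact hrot _ _ rfl
    have hadj : ∀ u v, G.Adj u v → c (M.faceAt u) = c (M.faceAt v) := by
      intro u v h
      have h1 := hat (⟨(u, v), h⟩, true)
      have h2 := hat ((⟨(u, v), h⟩ : G.Dart).symm, true)
      rw [face_symm] at h2
      exact h1.symm.trans h2
    have hreach : ∀ u v, G.Reachable u v → c (M.faceAt u) = c (M.faceAt v) := by
      rintro u v ⟨p⟩
      induction p with
      | nil => rfl
      | cons h _ ih => rw [hadj _ _ h, ih]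
    have hzero : ∀ v, c (M.faceAt v) = 0 := by
      intro v
      have h1 := congrFun h0 (G.connectedComponentMk v)
      have h2 : G.Reachable (G.connectedComponentMk v).out v :=
        ConnectedComponent.exact (Quot.out_eq _)
      exact (hreach _ _ h2).symm.trans h1
    ext q
    change c q = 0
    rcases q with q | v
    · obtain ⟨x, rfl⟩ := Quot.exists_rep q
      exact (hat x).trans (hzero _)
    · have := hzero v.1
      rwa [faceAt, dif_pos v.2] at this
  have h1 := LinearMap.finrank_le_finrank_of_injective hev
  have h2 := B.finrank_range_add_finrank_ker
  rw [hrange] at h2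
  rw [Module.finrank_fintype_fun_eq_card, ← Nat.card_eq_fintype_card] at h1 h2
  rw [Nat.card_sum] at h2
  unfold numFaces
  omega

/-- The face boundaries have codimension at most the Euler genus in the cycle space. (This
codimension is the rank of the first homology over `𝔽₂` of the surface.) -/
theorem finrank_cycleSpace_le {g : ℕ} (hM : M.eulerGenus ≤ g) :
    Module.finrank (ZMod 2) G.cycleSpace
      ≤ Module.finrank (ZMod 2) (LinearMap.range M.boundary) + g := by
  have h1 := G.finrank_cycleSpace_add_le
  have h2 := M.numFaces_le_finrank_range_boundary
  unfold eulerGenus at hM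
  omega

end CellularEmbedding

end SimpleGraph

/-! ### Subgraphs of graphs of bounded Euler genus are sparse -/

namespace SimpleGraph

variable {V : Type*} {G : SimpleGraph V}

/-- The edge vectors that vanish outside a set `S` of edges. -/
def supportedIn (S : Finset G.edgeSet) : Submodule (ZMod 2) (G.edgeSet → ZMod 2) where
  carrier := {z | ∀ e, e ∉ S → z e = 0}
  add_mem' h h' e he := by rw [Pi.add_apply, h e he, h' e he, add_zero]
  zero_mem' _ _ := rfl
  smul_mem' a z h e he := by rw [Pi.smul_apply, h e he, smul_zero]

/-- A set of edges in which no vertex has degree one. -/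
def IsLeafless (T : Finset (Sym2 V)) : Prop :=
  ∀ e ∈ T, ∀ v ∈ e, ∃ e' ∈ T, e' ≠ e ∧ v ∈ e'

variable [Fintype V]

theorem sum_ite_mem_edge (e : G.edgeSet) (a : ZMod 2) : ∑ v, (if v ∈ e.1 then a else 0) = 0 := by
  obtain ⟨e, he⟩ := e
  induction e with
  | h u v =>
    have : ∀ x, (if x ∈ s(u, v) then a else 0) = (if x ∈ ({u, v} : Finset V) then a else 0) := by
      intro x; simp
    simp only [this]
    rw [Finset.sum_ite_mem, Finset.univ_inter, Finset.sum_pair (G.ne_of_adj he)]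
    exact CharTwo.add_self_eq_zero a

/-- The degree conditions at the vertices of `U` define the cycle space of a graph on `U`, and one
of them is redundant. -/
theorem card_le_finrank_cycleSpace_inf (U : Finset V) (hU : U.Nonempty) (S : Finset G.edgeSet)
    (hS : ∀ e ∈ S, ∀ v ∈ e.1, v ∈ U) :
    S.card + 1 ≤ Module.finrank (ZMod 2) ↥(G.cycleSpace ⊓ supportedIn S) + U.card := by
  obtain ⟨u, hu⟩ := hU
  let ext : (S → ZMod 2) →ₗ[ZMod 2] (G.edgeSet → ZMod 2) :=
    { toFun := fun y e => if h : e ∈ S then y ⟨e, h⟩ else 0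
      map_add' := fun y y' => by
        ext e; by_cases h : e ∈ S <;> simp [h]
      map_smul' := fun a y => by
        ext e; by_cases h : e ∈ S <;> simp [h] }
  have hext : ∀ y e, e ∉ S → ext y e = 0 := fun y e h => dif_neg h
  let T : (S → ZMod 2) →ₗ[ZMod 2] (U.erase u → ZMod 2) :=
    (LinearMap.funLeft (ZMod 2) (ZMod 2) Subtype.val) ∘ₗ G.incidence.mulVecLin ∘ₗ ext
  have hT : ∀ y ∈ LinearMap.ker T, ext y ∈ G.cycleSpace ⊓ supportedIn S := by
    intro y hy
    refine ⟨?_, hext y⟩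
    rw [SetLike.mem_coe, mem_cycleSpace]
    have hne : ∀ v, v ≠ u → ∑ e, (if v ∈ e.1 then ext y e else 0) = 0 := by
      intro v hvu
      by_cases hv : v ∈ U
      · have h1 := congrFun (LinearMap.mem_ker.1 hy) ⟨v, Finset.mem_erase.2 ⟨hvu, hv⟩⟩
        have h2 : (G.incidence.mulVec (ext y)) v = 0 := h1
        simpa [incidence, Matrix.mulVec, dotProduct] using h2
      · refine Finset.sum_eq_zero fun e _ => ?_
        by_cases he : e ∈ S
        · rw [if_neg fun h => hv (hS e he v h)]
        · rw [hext y e he, ite_self]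
    intro v
    by_cases hvu : v = u
    · subst hvu
      have h1 : ∑ w, ∑ e, (if w ∈ e.1 then ext y e else 0) = 0 := by
        rw [Finset.sum_comm]
        exact Finset.sum_eq_zero fun e _ => sum_ite_mem_edge e _
      rwa [Finset.sum_eq_single v (fun w _ h => hne w h) (by simp)] at h1
    · exact hne v hvu
  let j : LinearMap.ker T →ₗ[ZMod 2] ↥(G.cycleSpace ⊓ supportedIn S) :=
    LinearMap.codRestrict _ (ext ∘ₗ Submodule.subtype _) fun y => hT y.1 y.2
  have hj : Function.Injective j := by
    rw [injective_iff_map_eq_zero]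
    intro y h0
    have h0' : ext y.1 = 0 := congrArg Subtype.val h0
    ext e
    have := congrFun h0' e.1
    simpa [ext] using this
  have h1 := LinearMap.finrank_le_finrank_of_injective hj
  have h2 := T.finrank_range_add_finrank_ker
  have h3 := Submodule.finrank_le (LinearMap.range T)
  rw [Module.finrank_fintype_fun_eq_card] at h2 h3
  simp only [Fintype.card_coe, Finset.card_erase_of_mem hu] at h2 h3
  have h4 : 0 < U.card := Finset.card_pos.2 ⟨u, hu⟩
  omega

theorem isLeafless_support {z : G.edgeSet → ZMod 2} (hz : z ∈ G.cycleSpace) :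
    IsLeafless ((Finset.univ.filter fun e => z e ≠ 0).image Subtype.val) := by
  intro e he v hv
  obtain ⟨e, hez, rfl⟩ := Finset.mem_image.1 he
  rw [Finset.mem_filter] at hez
  by_contra! hcon
  have h1 := mem_cycleSpace.1 hz v
  rw [Finset.sum_eq_single e ?_ (by simp), if_pos hv] at h1
  · exact hez.2 h1
  · intro e' _ hne
    by_cases h0 : z e' = 0
    · simp [h0]
    · rw [if_neg]
      exact hcon e'.1 (Finset.mem_image.2 ⟨e', by simp [h0], rfl⟩) fun h => hne (Subtype.ext h)

namespace CellularEmbedding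

variable (M : G.CellularEmbedding)

/-- The regions into which the edges of `S` divide the surface: the faces merged across all edges
outside `S`. -/
def Region (S : Finset G.edgeSet) : Type _ :=
  Quot fun a b : M.FacialWalk =>
    ∃ e ∉ S, a = M.face (edgeDart e, true) ∧ b = M.face (edgeDart e, false)

noncomputable instance (S : Finset G.edgeSet) : Fintype (M.Region S) :=
  have : Finite (M.Region S) := inferInstanceAs (Finite (Quot _))
  Fintype.ofFinite _

/-- The region that contains a face. -/
def region (S : Finset G.edgeSet) (a : M.FacialWalk) : M.Region S := Quot.mk _ a

/-- The boundary of a region. -/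
noncomputable def regionBoundary (S : Finset G.edgeSet) (q : M.Region S) : G.edgeSet → ZMod 2 :=
  M.boundary fun a => if M.region S a = q then 1 else 0

theorem regionBoundary_mem (S : Finset G.edgeSet) (q : M.Region S) :
    M.regionBoundary S q ∈ G.cycleSpace ⊓ supportedIn S := by
  refine ⟨M.boundary_mem_cycleSpace _, fun e he => ?_⟩
  have h : M.region S (M.face (edgeDart e, true)) = M.region S (M.face (edgeDart e, false)) :=
    Quot.sound ⟨e, he, rfl, rfl⟩
  rw [regionBoundary, boundary_apply, h]
  exact CharTwo.add_self_eq_zero _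

theorem sum_regionBoundary (S : Finset G.edgeSet) : ∑ q, M.regionBoundary S q = 0 := by
  simp only [regionBoundary]
  rw [← map_sum]
  ext e
  rw [boundary_apply]
  simp only [Finset.sum_apply, Finset.sum_ite_eq, Finset.mem_univ, if_true, Pi.zero_apply]
  exact CharTwo.add_self_eq_zero _

/-- Each edge lies on the boundary of at most two regions. -/
theorem card_filter_regionBoundary_le (S : Finset G.edgeSet) (e : G.edgeSet) :
    (Finset.univ.filter fun q => M.regionBoundary S q e ≠ 0).card ≤ 2 := by
  refine (Finset.card_le_card (t := ({M.region S (M.face (edgeDart e, true)),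
    M.region S (M.face (edgeDart e, false))} : Finset (M.Region S))) ?_).trans Finset.card_le_two
  intro q hq
  by_contra hcon
  simp only [Finset.mem_insert, Finset.mem_singleton, not_or] at hcon
  refine (Finset.mem_filter.1 hq).2 ?_
  rw [regionBoundary, boundary_apply, if_neg (Ne.symm hcon.1), if_neg (Ne.symm hcon.2), add_zero]

/-- The boundaries supported in `S` are the sums of region boundaries. -/
theorem range_boundary_inf_le_span (S : Finset G.edgeSet) :
    LinearMap.range M.boundary ⊓ supportedIn S
      ≤ Submodule.span (ZMod 2) (Set.range (M.regionBoundary S)) := by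
  rintro _ ⟨⟨c, rfl⟩, hc⟩
  have hc' : ∀ a b : M.FacialWalk, (∃ e ∉ S, a = M.face (edgeDart e, true) ∧
      b = M.face (edgeDart e, false)) → c a = c b := by
    rintro _ _ ⟨e, he, rfl, rfl⟩
    have := hc e he
    rw [boundary_apply] at this
    exact CharTwo.add_eq_zero.1 this
  let c' : M.Region S → ZMod 2 := Quot.lift c hc'
  have : M.boundary c = ∑ q, c' q • M.regionBoundary S q := by
    simp only [regionBoundary, ← map_smul]
    rw [← map_sum]
    congr 1
    ext a
    simp only [Finset.sum_apply, Pi.smul_apply, smul_eq_mul, mul_ite, mul_one, mul_zero,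
      Finset.sum_ite_eq, Finset.mem_univ, if_true]
    rfl
  rw [this]
  exact Submodule.sum_mem _ fun q _ =>
    Submodule.smul_mem _ _ (Submodule.subset_span ⟨q, rfl⟩)

theorem finrank_range_boundary_inf_le (S : Finset G.edgeSet) :
    Module.finrank (ZMod 2) ↥(LinearMap.range M.boundary ⊓ supportedIn S)
      ≤ (Finset.univ.filter fun q => M.regionBoundary S q ≠ 0).card - 1 := by
  set Q := Finset.univ.filter fun q => M.regionBoundary S q ≠ 0 with hQ
  have key : ∃ R : Finset (M.Region S), R.card ≤ Q.card - 1 ∧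
      ∀ q, M.regionBoundary S q ∈ Submodule.span (ZMod 2) (R.image (M.regionBoundary S) : Set _) := by
    have hmem : ∀ (R : Finset (M.Region S)), ∀ q ∈ R,
        M.regionBoundary S q ∈ Submodule.span (ZMod 2) (R.image (M.regionBoundary S) : Set _) :=
      fun R q hq => Submodule.subset_span (Finset.mem_coe.2 (Finset.mem_image_of_mem _ hq))
    rcases Q.eq_empty_or_nonempty with h | ⟨p, hp⟩
    · refine ⟨∅, by simp, fun q => ?_⟩
      have : q ∉ Q := by simp [h]
      have h0 : M.regionBoundary S q = 0 := by simpa [hQ] using this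
      rw [h0]
      exact Submodule.zero_mem _
    · refine ⟨Q.erase p, (Finset.card_erase_of_mem hp).le, fun q => ?_⟩
      by_cases hqQ : q ∈ Q
      · by_cases hqp : q = p
        · subst hqp
          have h1 := M.sum_regionBoundary S
          rw [← Finset.sum_filter_ne_zero, ← hQ, ← Finset.add_sum_erase _ _ hqQ] at h1
          rw [eq_neg_of_add_eq_zero_left h1]
          exact Submodule.neg_mem _ (Submodule.sum_mem _ fun q hq => hmem _ q hq)
        · exact hmem _ q (Finset.mem_erase.2 ⟨hqp, hqQ⟩)
      · have h0 : M.regionBoundary S q = 0 := by simpa [hQ] using hqQ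
        rw [h0]
        exact Submodule.zero_mem _
  obtain ⟨R, hR, hspan⟩ := key
  have h1 : LinearMap.range M.boundary ⊓ supportedIn S
      ≤ Submodule.span (ZMod 2) (R.image (M.regionBoundary S) : Set _) := by
    refine (M.range_boundary_inf_le_span S).trans (Submodule.span_le.2 ?_)
    rintro _ ⟨q, rfl⟩
    exact hspan q
  have h2 := finrank_span_finset_le_card (R := ZMod 2) (R.image (M.regionBoundary S))
  exact (Submodule.finrank_mono h1).trans (h2.trans (Finset.card_image_le.trans hR))

/-- Euler's inequality for subgraphs. Let `S` be a set of edges on a vertex set `U` in a graph of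
Euler genus at most `g`. If every nonempty leafless subset of `S` has at least `s` edges, then
`(s - 2) |S| ≤ s (|U| + g - 2)`. The numerical hypothesis on `s` covers the case that `S` bounds
no region. -/
theorem card_edges_le {g : ℕ} (hM : M.eulerGenus ≤ g) (U : Finset V) (hU : U.Nonempty)
    (S : Finset (Sym2 V)) (hSG : ∀ e ∈ S, e ∈ G.edgeSet) (hSU : ∀ e ∈ S, ∀ v ∈ e, v ∈ U)
    (s : ℕ) (h3s : 3 ≤ s) (hs : s + 2 ≤ 2 * (U.card + g))
    (hgirth : ∀ T ⊆ S, T.Nonempty → IsLeafless T → s ≤ T.card) :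
    s * S.card + 2 * s ≤ 2 * S.card + s * (U.card + g) := by
  let S' : Finset G.edgeSet := Finset.univ.filter fun e => e.1 ∈ S
  have hS' : S'.card = S.card := by
    refine Finset.card_bij (fun e _ => e.1) (by simp [S']) (fun _ _ _ _ h => Subtype.ext h) ?_
    intro e he
    exact ⟨⟨e, hSG e he⟩, by simpa [S'] using he, rfl⟩
  have hmemS' : ∀ e, e ∈ S' ↔ e.1 ∈ S := by simp [S']
  have h1 := card_le_finrank_cycleSpace_inf U hU S' fun e he => hSU _ ((hmemS' e).1 he)
  have h2 : Module.finrank (ZMod 2) ↥(G.cycleSpace ⊓ supportedIn S')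
      ≤ Module.finrank (ZMod 2) ↥(LinearMap.range M.boundary ⊓ supportedIn S') + g := by
    have e1 := Submodule.finrank_sup_add_finrank_inf_eq (LinearMap.range M.boundary)
      (G.cycleSpace ⊓ supportedIn S')
    have hBZ : LinearMap.range M.boundary ≤ G.cycleSpace := by
      rintro _ ⟨c, rfl⟩
      exact M.boundary_mem_cycleSpace c
    have e2 := Submodule.finrank_mono (sup_le hBZ
      (inf_le_left : G.cycleSpace ⊓ supportedIn S' ≤ G.cycleSpace))
    rw [← inf_assoc, inf_eq_left.2 hBZ] at e1
    have e3 := M.finrank_cycleSpace_le hM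
    omega
  have h3 := M.finrank_range_boundary_inf_le S'
  set Q := Finset.univ.filter fun q => M.regionBoundary S' q ≠ 0 with hQ
  have h4 : s * Q.card ≤ 2 * S'.card := by
    have hQs : ∀ q ∈ Q, s ≤ (S'.filter fun e => M.regionBoundary S' q e ≠ 0).card := by
      intro q hq
      have hz := M.regionBoundary_mem S' q
      have hne : M.regionBoundary S' q ≠ 0 := (Finset.mem_filter.1 hq).2
      have hfil : (S'.filter fun e => M.regionBoundary S' q e ≠ 0)
          = Finset.univ.filter fun e => M.regionBoundary S' q e ≠ 0 := by
        ext e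
        simp only [Finset.mem_filter, Finset.mem_univ, true_and, and_iff_right_iff_imp]
        exact fun h => by_contra fun he => h (hz.2 e he)
      have := hgirth ((S'.filter fun e => M.regionBoundary S' q e ≠ 0).image Subtype.val) ?_ ?_ ?_
      · exact this.trans Finset.card_image_le
      · intro e he
        obtain ⟨e, he', rfl⟩ := Finset.mem_image.1 he
        exact (hmemS' e).1 (Finset.mem_filter.1 he').1
      · obtain ⟨e, he⟩ := Function.ne_iff.1 hne
        rw [hfil]
        exact ⟨e.1, Finset.mem_image_of_mem _ (by simpa using he)⟩
      · rw [hfil]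
        exact isLeafless_support hz.1
    calc s * Q.card = ∑ q ∈ Q, s := by rw [Finset.sum_const, smul_eq_mul, mul_comm]
      _ ≤ ∑ q ∈ Q, (S'.filter fun e => M.regionBoundary S' q e ≠ 0).card := Finset.sum_le_sum hQs
      _ = ∑ e ∈ S', (Q.filter fun q => M.regionBoundary S' q e ≠ 0).card :=
        Finset.sum_card_bipartiteAbove_eq_sum_card_bipartiteBelow _
      _ ≤ ∑ e ∈ S', 2 := Finset.sum_le_sum fun e _ =>
        (Finset.card_le_card (Finset.filter_subset_filter _ (Finset.subset_univ _))).trans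
          (M.card_filter_regionBoundary_le S' e)
      _ = 2 * S'.card := by rw [Finset.sum_const, smul_eq_mul, mul_comm]
  rw [hS'] at h1 h4
  rcases Nat.eq_zero_or_pos Q.card with h0 | h0
  · have h5 : S.card + 1 ≤ U.card + g := by omega
    zify at h3s h5 hs ⊢
    nlinarith
  · have h5 : S.card + 2 ≤ U.card + g + Q.card := by omega
    have h6 := Nat.mul_le_mul_left s h5
    nlinarith

end CellularEmbedding

end SimpleGraph

/-! ### Vertices with few neighbours and few common neighbours -/

namespace SimpleGraph

variable {V : Type*} {G : SimpleGraph V}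

theorem IsLeafless.exists_ne {T : Finset (Sym2 V)} (hT : IsLeafless T) {u v : V}
    (h : s(u, v) ∈ T) : ∃ w, w ≠ v ∧ s(u, w) ∈ T := by
  obtain ⟨e, he, hne, hu⟩ := hT _ h u (Sym2.mem_mk_left u v)
  obtain ⟨w, rfl⟩ := Sym2.mem_iff_exists.1 hu
  exact ⟨w, fun hw => hne (by rw [hw]), he⟩

theorem IsLeafless.three_le_card {T : Finset (Sym2 V)} (hT : IsLeafless T) (hne : T.Nonempty)
    (hG : ∀ e ∈ T, e ∈ G.edgeSet) : 3 ≤ T.card := by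
  obtain ⟨e, he⟩ := hne
  induction e with
  | h u v =>
    have huv : u ≠ v := G.ne_of_adj (hG _ he)
    obtain ⟨w, hwv, hw⟩ := hT.exists_ne he
    obtain ⟨x, hxu, hx⟩ := hT.exists_ne (Sym2.eq_swap ▸ he : s(v, u) ∈ T)
    have h1 : s(u, v) ≠ s(u, w) := fun h => hwv (Sym2.congr_right.1 h).symm
    have h2 : s(u, v) ≠ s(v, x) := by
      rw [Sym2.eq_swap]
      exact fun h => hxu (Sym2.congr_right.1 h).symm
    have h3 : s(u, w) ≠ s(v, x) := by
      intro h
      rcases Sym2.eq_iff.1 h with h | h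
      · exact huv h.1
      · exact hwv h.2
    calc 3 = ({s(u, v), s(u, w), s(v, x)} : Finset (Sym2 V)).card := by
          rw [Finset.card_eq_three.2 ⟨_, _, _, h1, h2, h3, rfl⟩]
      _ ≤ T.card := Finset.card_le_card (by
          intro e
          simp only [Finset.mem_insert, Finset.mem_singleton]
          rintro (rfl | rfl | rfl) <;> assumption)

/-- The neighbours of `v` in `L`. -/
noncomputable def nbrsIn (G : SimpleGraph V) (L : Finset V) (v : V) : Finset V := L.filter (G.Adj v)

theorem mem_nbrsIn {L : Finset V} {u v : V} : u ∈ G.nbrsIn L v ↔ u ∈ L ∧ G.Adj v u :=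
  Finset.mem_filter

/-- The vertices of `L` other than `v` that are adjacent to `v` or have a common neighbour with `v`
outside `L`. -/
noncomputable def reachIn (G : SimpleGraph V) (L : Finset V) (v : V) : Finset V :=
  L.filter fun u => u ≠ v ∧ (G.Adj v u ∨ ∃ r, r ∉ L ∧ G.Adj r v ∧ G.Adj r u)

theorem mem_reachIn {L : Finset V} {u v : V} : u ∈ G.reachIn L v ↔
    u ∈ L ∧ u ≠ v ∧ (G.Adj v u ∨ ∃ r, r ∉ L ∧ G.Adj r v ∧ G.Adj r u) :=
  Finset.mem_filter

/-- The pairs `(r, a)` with `r ∈ R` and `a` a neighbour of `r` in `L`. -/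
noncomputable def pairsIn (G : SimpleGraph V) (R L : Finset V) : Finset (V × V) :=
  (R ×ˢ L).filter fun p => G.Adj p.1 p.2

theorem mem_pairsIn {R L : Finset V} {p : V × V} :
    p ∈ pairsIn G R L ↔ p.1 ∈ R ∧ p.2 ∈ L ∧ G.Adj p.1 p.2 := by
  rw [pairsIn, Finset.mem_filter, Finset.mem_product, and_assoc]

theorem card_pairsIn (R L : Finset V) :
    (pairsIn G R L).card = ∑ r ∈ R, (G.nbrsIn L r).card := by
  rw [pairsIn, Finset.card_filter, Finset.sum_product]
  refine Finset.sum_congr rfl fun r _ => ?_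
  rw [nbrsIn, Finset.card_filter]

/-- The reach of `v` is covered by its neighbours in `L` and the neighbourhoods in `L` of the
vertices of `R`, if `R` represents all neighbourhoods of size at least two. -/
theorem card_reachIn_le {R L : Finset V}
    (hR : ∀ r, r ∉ L → 2 ≤ (G.nbrsIn L r).card → ∃ r' ∈ R, G.nbrsIn L r' = G.nbrsIn L r)
    {v : V} (hv : v ∈ L) :
    (G.reachIn L v).card ≤ (G.nbrsIn L v).card +
      ∑ r ∈ R.filter (fun r => G.Adj r v), ((G.nbrsIn L r).card - 1) := by
  have hsub : G.reachIn L v ⊆ G.nbrsIn L v ∪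
      (R.filter (fun r => G.Adj r v)).biUnion fun r => (G.nbrsIn L r).erase v := by
    intro u hu
    obtain ⟨huL, huv, h | ⟨r, hrL, hrv, hru⟩⟩ := mem_reachIn.1 hu
    · exact Finset.mem_union_left _ (mem_nbrsIn.2 ⟨huL, h⟩)
    · have hu' : u ∈ G.nbrsIn L r := mem_nbrsIn.2 ⟨huL, hru⟩
      have hv' : v ∈ G.nbrsIn L r := mem_nbrsIn.2 ⟨hv, hrv⟩
      obtain ⟨r', hr', heq⟩ := hR r hrL (Finset.one_lt_card.2 ⟨u, hu', v, hv', huv⟩)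
      refine Finset.mem_union_right _ (Finset.mem_biUnion.2 ⟨r', ?_, ?_⟩)
      · rw [← heq] at hv'
        exact Finset.mem_filter.2 ⟨hr', (mem_nbrsIn.1 hv').2⟩
      · rw [heq]
        exact Finset.mem_erase.2 ⟨huv, hu'⟩
  refine (Finset.card_le_card hsub).trans ((Finset.card_union_le _ _).trans ?_)
  refine Nat.add_le_add_left (Finset.card_biUnion_le.trans (Finset.sum_le_sum fun r hr => ?_)) _
  rw [Finset.card_erase_of_mem (mem_nbrsIn.2 ⟨hv, (Finset.mem_filter.1 hr).2⟩)]

namespace CellularEmbedding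

variable [Fintype V] {M : G.CellularEmbedding} {g : ℕ}

/-- Euler's inequality for the subgraph induced on `L`. -/
theorem sum_card_nbrsIn_le (hM : M.eulerGenus ≤ g) {L : Finset V} (hL : L.Nonempty)
    (hcard : 5 ≤ 2 * (L.card + g)) :
    ∑ v ∈ L, (G.nbrsIn L v).card + 12 ≤ 6 * (L.card + g) := by
  let D : Finset (Σ _ : V, V) := L.sigma fun v => G.nbrsIn L v
  have hD : D.card = ∑ v ∈ L, (G.nbrsIn L v).card := Finset.card_sigma _ _
  let S : Finset (Sym2 V) := D.image fun p => s(p.1, p.2)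
  have hS : ∀ e ∈ S, ∃ u v, e = s(u, v) ∧ u ∈ L ∧ v ∈ L ∧ G.Adj u v := by
    intro e he
    obtain ⟨⟨u, v⟩, hp, rfl⟩ := Finset.mem_image.1 he
    obtain ⟨hu, hv⟩ := Finset.mem_sigma.1 hp
    exact ⟨u, v, rfl, hu, (mem_nbrsIn.1 hv).1, (mem_nbrsIn.1 hv).2⟩
  have hDS : D.card ≤ 2 * S.card := by
    refine Finset.card_le_mul_card_image D 2 fun e he => ?_
    obtain ⟨u, v, rfl, -⟩ := hS e he
    refine (Finset.card_le_card (t := ({⟨u, v⟩, ⟨v, u⟩} : Finset (Σ _ : V, V))) ?_).trans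
      Finset.card_le_two
    rintro ⟨x, y⟩ hp
    rcases Sym2.eq_iff.1 (Finset.mem_filter.1 hp).2 with ⟨rfl, rfl⟩ | ⟨rfl, rfl⟩ <;> simp
  have hSG : ∀ e ∈ S, e ∈ G.edgeSet := by
    intro e he
    obtain ⟨u, v, rfl, -, -, h⟩ := hS e he
    exact h
  have := M.card_edges_le hM L hL S hSG (by
      intro e he w hw
      obtain ⟨u, v, rfl, hu, hv, -⟩ := hS e he
      rcases Sym2.mem_iff.1 hw with rfl | rfl <;> assumption) 3 le_rfl hcard
    fun T hTS hT hleaf => hleaf.three_le_card hT fun e he => hSG e (hTS he)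
  omega

/-- Euler's inequality for bipartite subgraphs, with the edges given as a set `D` of pairs. -/
theorem card_bipartite_le (hM : M.eulerGenus ≤ g) {R L : Finset V} (hL : L.Nonempty)
    (hRL : Disjoint R L) (D : Finset (V × V))
    (hD : ∀ p ∈ D, p.1 ∈ R ∧ p.2 ∈ L ∧ G.Adj p.1 p.2)
    (s : ℕ) (h3s : 3 ≤ s) (hs : s + 2 ≤ 2 * (L.card + g))
    (hgirth : ∀ T ⊆ D, T.Nonempty →
      (∀ r a, (r, a) ∈ T → ∃ b, b ≠ a ∧ (r, b) ∈ T) →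
      (∀ r a, (r, a) ∈ T → ∃ r', r' ≠ r ∧ (r', a) ∈ T) → s ≤ T.card) :
    s * D.card + 2 * s ≤ 2 * D.card + s * (R.card + L.card + g) := by
  have hdisj : ∀ x, x ∈ R → x ∉ L := fun _ hx => Finset.disjoint_left.1 hRL hx
  have hinj : ∀ p ∈ D, ∀ q : V × V, q ∈ D → s(p.1, p.2) = s(q.1, q.2) → p = q := by
    intro p hp q hq h
    rcases Sym2.eq_iff.1 h with h | h
    · exact Prod.ext h.1 h.2
    · exact absurd (h.1 ▸ (hD q hq).2.1) (hdisj _ (hD p hp).1)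
  let S : Finset (Sym2 V) := D.image fun p => s(p.1, p.2)
  have hScard : S.card = D.card := Finset.card_image_of_injOn fun p hp q hq => hinj p hp q hq
  have h := M.card_edges_le hM (R ∪ L) (hL.mono Finset.subset_union_right) S ?_ ?_ s h3s ?_ ?_
  · rwa [hScard, Finset.card_union_of_disjoint hRL] at h
  · intro e he
    obtain ⟨p, hp, rfl⟩ := Finset.mem_image.1 he
    exact (hD p hp).2.2
  · intro e he w hw
    obtain ⟨p, hp, rfl⟩ := Finset.mem_image.1 he
    rw [Finset.mem_union]
    rcases Sym2.mem_iff.1 hw with rfl | rfl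
    · exact Or.inl (hD p hp).1
    · exact Or.inr (hD p hp).2.1
  · rw [Finset.card_union_of_disjoint hRL]
    omega
  · intro T hTS hT hleaf
    let T' := D.filter fun p => s(p.1, p.2) ∈ T
    have hmem : ∀ x y, x ∈ R → s(x, y) ∈ T → (x, y) ∈ T' := by
      intro x y hx h
      obtain ⟨⟨p, q⟩, hp, hpe⟩ := Finset.mem_image.1 (hTS h)
      refine Finset.mem_filter.2 ⟨?_, h⟩
      rcases Sym2.eq_iff.1 hpe with ⟨rfl, rfl⟩ | ⟨rfl, rfl⟩
      · exact hp
      · exact absurd (hD _ hp).2.1 (hdisj _ hx)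
    have hmem' : ∀ x y, y ∈ L → s(y, x) ∈ T → (x, y) ∈ T' := by
      intro x y hy h
      rw [Sym2.eq_swap] at h
      refine hmem x y ?_ h
      obtain ⟨⟨p, q⟩, hp, hpe⟩ := Finset.mem_image.1 (hTS h)
      rcases Sym2.eq_iff.1 hpe with ⟨rfl, rfl⟩ | ⟨rfl, rfl⟩
      · exact (hD _ hp).1
      · exact absurd hy (hdisj _ (hD _ hp).1)
    have hcard : T'.card ≤ T.card := by
      refine Finset.card_le_card_of_injOn (fun p => s(p.1, p.2))
        (fun p hp => (Finset.mem_filter.1 hp).2) ?_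
      intro p hp q hq
      exact hinj p (Finset.mem_filter.1 hp).1 q (Finset.mem_filter.1 hq).1
    refine (hgirth T' (Finset.filter_subset _ _) ?_ ?_ ?_).trans hcard
    · obtain ⟨e, he⟩ := hT
      obtain ⟨p, hp, rfl⟩ := Finset.mem_image.1 (hTS he)
      exact ⟨p, Finset.mem_filter.2 ⟨hp, he⟩⟩
    · intro r a h
      obtain ⟨h1, h2⟩ := Finset.mem_filter.1 h
      obtain ⟨b, hb, hb'⟩ := hleaf.exists_ne h2
      exact ⟨b, hb, hmem _ _ (hD _ h1).1 hb'⟩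
    · intro r a h
      obtain ⟨h1, h2⟩ := Finset.mem_filter.1 h
      obtain ⟨b, hb, hb'⟩ := hleaf.exists_ne (Sym2.eq_swap ▸ h2 : s(a, r) ∈ T)
      exact ⟨b, hb, hmem' _ _ (hD _ h1).2.1 hb'⟩

/-- Bipartite graphs have no cycles of length less than four. -/
theorem card_pairsIn_add_le (hM : M.eulerGenus ≤ g) {R L : Finset V} (hL : L.Nonempty)
    (hRL : Disjoint R L) (hcard : 3 ≤ L.card + g) :
    (pairsIn G R L).card + 4 ≤ 2 * (R.card + L.card + g) := by
  have := card_bipartite_le hM hL hRL (pairsIn G R L) (fun p hp => mem_pairsIn.1 hp) 4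
    (by norm_num) (by omega) ?_
  · omega
  · rintro T - ⟨⟨r, a⟩, h⟩ hr ha
    obtain ⟨b, hb, hrb⟩ := hr r a h
    obtain ⟨r₂, hr₂, hra₂⟩ := ha r a h
    obtain ⟨r₃, hr₃, hrb₃⟩ := ha r b hrb
    have hsub : ({(r, a), (r, b), (r₂, a), (r₃, b)} : Finset (V × V)) ⊆ T := by
      intro p
      simp only [Finset.mem_insert, Finset.mem_singleton]
      rintro (rfl | rfl | rfl | rfl) <;> assumption
    refine le_trans (le_of_eq ?_) (Finset.card_le_card hsub)
    rw [Finset.card_insert_of_notMem, Finset.card_insert_of_notMem, Finset.card_insert_of_notMem,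
      Finset.card_singleton] <;>
    simp only [Finset.mem_insert, Finset.mem_singleton, Prod.mk.injEq] <;> grind

/-- If the vertices of `R` have two neighbours each in `L`, and no two of them have the same two,
then they subdivide the edges of a simple graph on `L`, so that there are no cycles of length less
than six. -/
theorem two_mul_card_add_le (hM : M.eulerGenus ≤ g) {R L : Finset V} (hL : L.Nonempty)
    (hRL : Disjoint R L) (hcard : 4 ≤ L.card + g) (h2 : ∀ r ∈ R, (G.nbrsIn L r).card = 2)
    (hinj : Set.InjOn (G.nbrsIn L) R) :
    2 * R.card + 12 ≤ 6 * (L.card + g) := by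
  have hc : (pairsIn G R L).card = 2 * R.card := by
    rw [card_pairsIn, Finset.sum_congr rfl h2, Finset.sum_const, smul_eq_mul, mul_comm]
  have := card_bipartite_le hM hL hRL (pairsIn G R L) (fun p hp => mem_pairsIn.1 hp) 6
    (by norm_num) (by omega) ?_
  · omega
  · rintro T hTD ⟨⟨r₁, a⟩, h₁a⟩ hr ha
    have hmem : ∀ r x, (r, x) ∈ T → r ∈ R ∧ x ∈ G.nbrsIn L r := by
      intro r x h
      have := mem_pairsIn.1 (hTD h)
      exact ⟨this.1, mem_nbrsIn.2 this.2⟩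
    have hpair : ∀ r x y, (r, x) ∈ T → (r, y) ∈ T → x ≠ y → G.nbrsIn L r = {x, y} := by
      intro r x y hx hy hxy
      refine (Finset.eq_of_subset_of_card_le ?_ ?_).symm
      · intro z hz
        rcases Finset.mem_insert.1 hz with rfl | hz
        · exact (hmem _ _ hx).2
        · rw [Finset.mem_singleton.1 hz]
          exact (hmem _ _ hy).2
      · rw [h2 r (hmem _ _ hx).1, Finset.card_pair hxy]
    obtain ⟨b, hba, h₁b⟩ := hr r₁ a h₁a
    obtain ⟨r₂, hr₂, h₂a⟩ := ha r₁ a h₁a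
    obtain ⟨c, hca, h₂c⟩ := hr r₂ a h₂a
    have hcb : c ≠ b := by
      rintro rfl
      refine hr₂ (hinj (hmem _ _ h₂a).1 (hmem _ _ h₁a).1 ?_)
      rw [hpair _ _ _ h₁a h₁b hba.symm, hpair _ _ _ h₂a h₂c hca.symm]
    obtain ⟨r₃, hr₃, h₃b⟩ := ha r₁ b h₁b
    have hr₃₂ : r₃ ≠ r₂ := by
      rintro rfl
      have := (hmem _ _ h₃b).2
      rw [hpair _ _ _ h₂a h₂c hca.symm] at this
      simp [hba, hcb.symm] at this
    obtain ⟨d, hdb, h₃d⟩ := hr r₃ b h₃b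
    have hsub : ({(r₁, a), (r₁, b), (r₂, a), (r₂, c), (r₃, b), (r₃, d)} : Finset (V × V)) ⊆ T := by
      intro p
      simp only [Finset.mem_insert, Finset.mem_singleton]
      rintro (rfl | rfl | rfl | rfl | rfl | rfl) <;> assumption
    refine le_trans (le_of_eq ?_) (Finset.card_le_card hsub)
    rw [Finset.card_insert_of_notMem, Finset.card_insert_of_notMem, Finset.card_insert_of_notMem,
      Finset.card_insert_of_notMem, Finset.card_insert_of_notMem, Finset.card_singleton] <;>
    simp only [Finset.mem_insert, Finset.mem_singleton, Prod.mk.injEq] <;> grind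

/-- The neighbours in `L`, the vertices outside `L` with two neighbours in `L`, and those with at
least three contribute `6`, `6` and `24` to the constant `36`. Vertices outside `L` with the same
neighbours in `L` are counted once. -/
theorem sum_card_reachIn_le (hM : M.eulerGenus ≤ g) {L : Finset V} (hL : L.Nonempty)
    (hcard : 4 ≤ L.card + g) (hdeg : ∀ r, r ∉ L → (G.nbrsIn L r).card ≤ 10) :
    ∑ v ∈ L, (G.reachIn L v).card + 72 ≤ 36 * (L.card + g) := by
  let R₀ : Finset V := Finset.univ.filter fun r => r ∉ L ∧ 2 ≤ (G.nbrsIn L r).card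
  obtain ⟨R, hRR₀, hinj, himg⟩ : ∃ R ⊆ R₀, Set.InjOn (G.nbrsIn L) R ∧
      R.image (G.nbrsIn L) = R₀.image (G.nbrsIn L) := by
    obtain ⟨R, h1, h2, h3⟩ := Finset.exists_subset_injOn_image_eq_of_surjOn (f := G.nbrsIn L)
      (R₀ : Set V) (R₀.image (G.nbrsIn L)) (by rw [Finset.coe_image]; exact Set.surjOn_image _ _)
    exact ⟨R, by exact_mod_cast h1, h2, h3⟩
  have hR : ∀ r ∈ R, r ∉ L ∧ 2 ≤ (G.nbrsIn L r).card := fun r hr => by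
    simpa [R₀] using hRR₀ hr
  have hrep : ∀ r, r ∉ L → 2 ≤ (G.nbrsIn L r).card →
      ∃ r' ∈ R, G.nbrsIn L r' = G.nbrsIn L r := by
    intro r h1 h2
    have : G.nbrsIn L r ∈ R.image (G.nbrsIn L) := by
      rw [himg]
      exact Finset.mem_image_of_mem _ (by simp [R₀, h1, h2])
    exact Finset.mem_image.1 this
  have hdisj : Disjoint R L := Finset.disjoint_left.2 fun r hr => (hR r hr).1
  have hswap : ∑ v ∈ L, ∑ r ∈ R.filter (fun r => G.Adj r v), ((G.nbrsIn L r).card - 1)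
      = ∑ r ∈ R, (G.nbrsIn L r).card * ((G.nbrsIn L r).card - 1) := by
    simp only [Finset.sum_filter]
    rw [Finset.sum_comm]
    refine Finset.sum_congr rfl fun r _ => ?_
    rw [← Finset.sum_filter, Finset.sum_const, smul_eq_mul]
    rfl
  have hsum : ∑ v ∈ L, (G.reachIn L v).card ≤ ∑ v ∈ L, (G.nbrsIn L v).card +
      ∑ r ∈ R, (G.nbrsIn L r).card * ((G.nbrsIn L r).card - 1) := by
    rw [← hswap, ← Finset.sum_add_distrib]
    exact Finset.sum_le_sum fun v hv => card_reachIn_le hrep hv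
  have hL1 := sum_card_nbrsIn_le hM hL (by omega)
  rw [← Finset.sum_filter_add_sum_filter_not R (fun r => (G.nbrsIn L r).card = 2)] at hsum
  set R₂ := R.filter fun r => (G.nbrsIn L r).card = 2 with hR₂
  set R₃ := R.filter fun r => ¬ (G.nbrsIn L r).card = 2 with hR₃
  have h2 : 2 * R₂.card + 12 ≤ 6 * (L.card + g) :=
    two_mul_card_add_le hM hL (Finset.disjoint_of_subset_left (Finset.filter_subset _ _) hdisj)
      hcard (fun r hr => (Finset.mem_filter.1 hr).2)
      (hinj.mono fun r hr => (Finset.mem_filter.1 hr).1)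
  have h2' : ∑ r ∈ R₂, (G.nbrsIn L r).card * ((G.nbrsIn L r).card - 1) = 2 * R₂.card := by
    rw [Finset.sum_congr rfl (g := fun _ => 2), Finset.sum_const, smul_eq_mul, mul_comm]
    intro r hr
    rw [(Finset.mem_filter.1 hr).2]
  have h3 := card_pairsIn_add_le (R := R₃) hM hL
    (Finset.disjoint_of_subset_left (Finset.filter_subset _ _) hdisj) (by omega)
  rw [card_pairsIn] at h3
  -- `d (d - 1) ≤ 12 (d - 2)` for `3 ≤ d ≤ 10`
  have h3' : ∑ r ∈ R₃, ((G.nbrsIn L r).card * ((G.nbrsIn L r).card - 1) + 24)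
      ≤ ∑ r ∈ R₃, 12 * (G.nbrsIn L r).card := by
    refine Finset.sum_le_sum fun r hr => ?_
    obtain ⟨hrR, hr2⟩ := Finset.mem_filter.1 hr
    have h4 := hR r hrR
    have h5 := hdeg r h4.1
    generalize (G.nbrsIn L r).card = d at *
    have h6 : 3 ≤ d := by omega
    interval_cases d <;> norm_num
  rw [Finset.sum_add_distrib, Finset.sum_const, smul_eq_mul, ← Finset.mul_sum] at h3'
  omega

/-- If vertices are removed from the graph one after the other and `L` is what remains, then this
gives the next vertex to remove, as long as more than `6 g` vertices remain. Up to `138 g - 162`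
vertices, the bound on the reach is trivial and the average degree in `L` suffices. -/
theorem exists_card_nbrsIn_le_card_reachIn_lt (hg : 2 ≤ g) (hM : M.eulerGenus ≤ g) {L : Finset V}
    (hL : 6 * g < L.card) (hdeg : ∀ r, r ∉ L → (G.nbrsIn L r).card ≤ 10) :
    ∃ v ∈ L, (G.nbrsIn L v).card ≤ 10 ∧ (G.reachIn L v).card < 138 * g - 162 := by
  have hne : L.Nonempty := Finset.card_pos.1 (by omega)
  have h1 := sum_card_nbrsIn_le hM hne (by omega)
  by_contra! hcon
  rcases le_or_gt L.card (138 * g - 162) with hsmall | hlarge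
  · have : ∀ v ∈ L, 11 ≤ (G.nbrsIn L v).card := by
      intro v hv
      by_contra! h
      have h2 := hcon v hv (by omega)
      have h3 : (G.reachIn L v).card ≤ (L.erase v).card := by
        refine Finset.card_le_card fun u hu => ?_
        obtain ⟨huL, huv, -⟩ := mem_reachIn.1 hu
        exact Finset.mem_erase.2 ⟨huv, huL⟩
      rw [Finset.card_erase_of_mem hv] at h3
      omega
    have := Finset.card_nsmul_le_sum L _ 11 this
    rw [smul_eq_mul] at this
    omega
  · have h2 := sum_card_reachIn_le hM hne (by omega) hdeg
    -- either the degree is at least `11` or the reach has at least `138 g - 162 ≥ 114` vertices,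
    -- and `11 * 114 = 1254`
    have : ∀ v ∈ L, 1254 ≤ 114 * (G.nbrsIn L v).card + 11 * (G.reachIn L v).card := by
      intro v hv
      have := hcon v hv
      omega
    have := Finset.card_nsmul_le_sum L _ 1254 this
    rw [smul_eq_mul, Finset.sum_add_distrib, ← Finset.mul_sum, ← Finset.mul_sum] at this
    omega

end CellularEmbedding

end SimpleGraph

/-! ### Colouring along the ordering -/

namespace OrientedGraph

variable {V W : Type*}

/-- The partial homomorphisms of the greedy colouring. The edges of `G` with both ends mapped to the
last `m` partite sets are ignored, but `φ` sends at most one vertex of `L` to each of these sets. The last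
condition keeps `φ` extendable to the vertices outside `L`. -/
structure IsPartialHom (G : OrientedGraph V) (K : OrientedGraph W) {k : ℕ} (part : W → Fin k)
    (m : ℕ) (L : Finset V) (φ : V → W) : Prop where
  injOn_last : ∀ u ∈ L, ∀ v ∈ L, k ≤ (part (φ u) : ℕ) + m → part (φ u) = part (φ v) → u = v
  adj : ∀ u ∈ L, ∀ v ∈ L, G.Adj u v →
    (k ≤ (part (φ u) : ℕ) + m ∧ k ≤ (part (φ v) : ℕ) + m) ∨ K.Adj (φ u) (φ v)
  injOn_nbrs : ∀ r, r ∉ L → ∀ u ∈ G.underlying.nbrsIn L r, ∀ v ∈ G.underlying.nbrsIn L r,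
    part (φ u) = part (φ v) → u = v

variable {G : OrientedGraph V} {K : OrientedGraph W} {k m d N : ℕ} {part : W → Fin k}

theorem IsFull.surjective_part (hK : K.IsFull k d N part) : Function.Surjective part := by
  intro i
  obtain ⟨x, hx, -⟩ := hK.full i 0 (Nat.zero_le d) ⟨Fin.elim0, fun j => j.elim0⟩
    (fun j => j.elim0) Fin.elim0
  exact ⟨x, hx⟩

theorem exists_isPartialHom_of_card_le (hK : K.IsFull k d N part) (hk : 0 < k) (hm : m ≤ k)
    {L : Finset V} (hL : L.card ≤ m) : ∃ φ, G.IsPartialHom K part m L φ := by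
  obtain ⟨vtx, hvtx⟩ := hK.surjective_part.hasRightInverse
  let idx : V → Fin k := fun v =>
    if h : v ∈ L then ⟨k - m + L.equivFin ⟨v, h⟩, by have := (L.equivFin ⟨v, h⟩).2; omega⟩
    else ⟨0, hk⟩
  have hlast : ∀ v ∈ L, k ≤ (idx v : ℕ) + m := by
    intro v hv
    simp only [idx, dif_pos hv]
    omega
  have hinj : ∀ u ∈ L, ∀ v ∈ L, idx u = idx v → u = v := by
    intro u hu v hv h
    simp only [idx, dif_pos hu, dif_pos hv, Fin.mk.injEq, Nat.add_left_cancel_iff] at h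
    exact congrArg Subtype.val (L.equivFin.injective (Fin.ext h))
  have hpart : ∀ v, part (vtx (idx v)) = idx v := fun v => hvtx _
  refine ⟨fun v => vtx (idx v), ?_, ?_, ?_⟩
  · intro u hu v hv _ h
    rw [hpart, hpart] at h
    exact hinj u hu v hv h
  · intro u hu v hv _
    rw [hpart, hpart]
    exact Or.inl ⟨hlast u hu, hlast v hv⟩
  · intro r _ u hu v hv h
    rw [hpart, hpart] at h
    exact hinj u (SimpleGraph.mem_nbrsIn.1 hu).1 v (SimpleGraph.mem_nbrsIn.1 hv).1 h

/-- A vertex with at most `d` neighbours in `L`, whose reach has fewer vertices than there are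
partite sets other than the last `m`, can be coloured after the rest of `L`. -/
theorem IsPartialHom.extend (hK : K.IsFull k d N part) {L : Finset V} {v : V} (hv : v ∈ L)
    (hdeg : (G.underlying.nbrsIn L v).card ≤ d)
    (hreach : (G.underlying.reachIn L v).card < k - m)
    {φ : V → W} (hφ : G.IsPartialHom K part m (L.erase v) φ) :
    ∃ ψ, G.IsPartialHom K part m L ψ := by
  obtain ⟨i, hi, hifree⟩ : ∃ i : Fin k, (i : ℕ) < k - m ∧
      ∀ u ∈ G.underlying.reachIn L v, part (φ u) ≠ i := by
    have hc : ((G.underlying.reachIn L v).image fun u => (part (φ u) : ℕ)).card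
        < (Finset.range (k - m)).card := by
      rw [Finset.card_range]
      exact Finset.card_image_le.trans_lt hreach
    obtain ⟨i, hi, hi'⟩ := Finset.exists_mem_notMem_of_card_lt_card hc
    rw [Finset.mem_range] at hi
    refine ⟨⟨i, by omega⟩, hi, fun u hu h => hi' (Finset.mem_image.2 ⟨u, hu, ?_⟩)⟩
    rw [h]
  have hmem : ∀ r, ∀ u ∈ G.underlying.nbrsIn L r, u ≠ v →
      u ∈ G.underlying.nbrsIn (L.erase v) r := by
    intro r u hu huv
    have := SimpleGraph.mem_nbrsIn.1 hu
    exact SimpleGraph.mem_nbrsIn.2 ⟨Finset.mem_erase.2 ⟨huv, this.1⟩, this.2⟩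
  have hne : ∀ u ∈ G.underlying.nbrsIn L v, u ≠ v := by
    rintro u hu rfl
    exact G.underlying.irrefl (SimpleGraph.mem_nbrsIn.1 hu).2
  let e := (G.underlying.nbrsIn L v).equivFin.symm
  let u : Fin (G.underlying.nbrsIn L v).card ↪ W :=
    ⟨fun j => φ (e j), fun j j' h => e.injective (Subtype.ext
      (hφ.injOn_nbrs v (Finset.notMem_erase v L) _ (hmem _ _ (e j).2 (hne _ (e j).2)) _
        (hmem _ _ (e j').2 (hne _ (e j').2)) (congrArg part h)))⟩
  obtain ⟨x, hx, hpat⟩ := hK.full i _ hdeg u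
    (fun j => hifree _ (SimpleGraph.mem_reachIn.2 ⟨(SimpleGraph.mem_nbrsIn.1 (e j).2).1,
      hne _ (e j).2, Or.inl (SimpleGraph.mem_nbrsIn.1 (e j).2).2⟩))
    (fun j => if G.Adj v (e j) then 1 else -1)
  have hout : ∀ w ∈ L, G.Adj v w → K.Adj x (φ w) := by
    intro w hw h
    obtain ⟨j, hj⟩ := e.surjective ⟨w, SimpleGraph.mem_nbrsIn.2 ⟨hw, Or.inl h⟩⟩
    have huj : u j = φ w := congrArg (fun y => φ y.1) hj
    exact huj ▸ (hpat j).1 (by simp only [hj, if_pos h])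
  have hin : ∀ w ∈ L, G.Adj w v → K.Adj (φ w) x := by
    intro w hw h
    obtain ⟨j, hj⟩ := e.surjective ⟨w, SimpleGraph.mem_nbrsIn.2 ⟨hw, Or.inr h⟩⟩
    have huj : u j = φ w := congrArg (fun y => φ y.1) hj
    exact huj ▸ (hpat j).2 (by simp only [hj, if_neg (G.asymm _ _ h)])
  let ψ := Function.update φ v x
  have hψv : ψ v = x := Function.update_self ..
  have hψ : ∀ w, w ≠ v → ψ w = φ w := fun w hw => Function.update_of_ne hw ..
  have herase : ∀ w ∈ L, w ≠ v → w ∈ L.erase v := fun w hw h => Finset.mem_erase.2 ⟨h, hw⟩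
  refine ⟨ψ, ?_, ?_, ?_⟩
  · intro a ha b hb hlast hab
    have ha' : a ≠ v := by
      rintro rfl
      rw [hψv, hx] at hlast
      omega
    have hb' : b ≠ v := by
      rintro rfl
      rw [hab, hψv, hx] at hlast
      omega
    rw [hψ a ha'] at hlast hab
    rw [hψ b hb'] at hab
    exact hφ.injOn_last a (herase a ha ha') b (herase b hb hb') hlast hab
  · intro a ha b hb hab
    by_cases ha' : a = v
    · subst ha'
      have hb' : b ≠ a := fun h => G.asymm _ _ hab (h ▸ h ▸ hab)
      rw [hψv, hψ b hb']
      exact Or.inr (hout b hb hab)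
    · by_cases hb' : b = v
      · subst hb'
        rw [hψv, hψ a ha']
        exact Or.inr (hin a ha hab)
      · rw [hψ a ha', hψ b hb']
        exact hφ.adj a (herase a ha ha') b (herase b hb hb') hab
  · intro r hr a ha b hb hab
    have hrv : r ∉ L.erase v := fun h => hr (Finset.mem_of_mem_erase h)
    -- a vertex sharing the neighbour `r` with `v` lies in the reach of `v`
    have hfree : ∀ w ∈ G.underlying.nbrsIn L r, v ∈ G.underlying.nbrsIn L r → w ≠ v →
        part (φ w) ≠ i := by
      intro w hw hvr hwv
      have hw' := SimpleGraph.mem_nbrsIn.1 hw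
      exact hifree w (SimpleGraph.mem_reachIn.2
        ⟨hw'.1, hwv, Or.inr ⟨r, hr, (SimpleGraph.mem_nbrsIn.1 hvr).2, hw'.2⟩⟩)
    by_cases ha' : a = v <;> by_cases hb' : b = v
    · rw [ha', hb']
    · subst ha'
      rw [hψv, hx, hψ b hb'] at hab
      exact absurd hab.symm (hfree b hb ha hb')
    · subst hb'
      rw [hψv, hx, hψ a ha'] at hab
      exact absurd hab (hfree a ha hb ha')
    · rw [hψ a ha', hψ b hb'] at hab
      exact hφ.injOn_nbrs r hrv a (hmem r a ha ha') b (hmem r b hb hb') hab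

/-- At most `6 g` vertices get a last partite set each; the others follow one by one, in the order in
which `exists_card_nbrsIn_le_card_reachIn_lt` finds them from the end. -/
theorem exists_isPartialHom [Finite V] {g : ℕ} (hg : 2 ≤ g) {part : W → Fin (144 * g - 162)}
    (hK : K.IsFull (144 * g - 162) 10 N part) (hG : G.underlying.eulerGenus ≤ g) (L : Finset V)
    (hL : ∀ r, r ∉ L → (G.underlying.nbrsIn L r).card ≤ 10) :
    ∃ φ, G.IsPartialHom K part (6 * g) L φ := by
  have := Fintype.ofFinite V
  obtain ⟨M, hM⟩ := (G.underlying.eulerGenus_le_iff g).1 hG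
  induction L using Finset.strongInduction with
  | H L ih =>
    rcases le_or_gt L.card (6 * g) with hcard | hcard
    · exact exists_isPartialHom_of_card_le hK (by omega) (by omega) hcard
    · obtain ⟨v, hv, hdeg, hreach⟩ :=
        SimpleGraph.CellularEmbedding.exists_card_nbrsIn_le_card_reachIn_lt hg hM hcard hL
      have hmono : ∀ r, (G.underlying.nbrsIn (L.erase v) r).card
          ≤ (G.underlying.nbrsIn L r).card := fun r =>
        Finset.card_le_card (Finset.filter_subset_filter _ (Finset.erase_subset v L))
      obtain ⟨φ, hφ⟩ := ih (L.erase v) (Finset.erase_ssubset hv) (by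
        intro r hr
        by_cases hrv : r = v
        · rw [hrv]
          exact (hmono v).trans hdeg
        · exact (hmono r).trans (hL r fun h => hr (Finset.mem_erase.2 ⟨hrv, h⟩)))
      exact hφ.extend hK hv hdeg (by omega)

end OrientedGraph

theorem theorem4p1 {W : Type*} (g : ℕ) (hg : 2 ≤ g) (N : ℕ)
    (K : OrientedGraph W) (part : W → Fin (144 * g - 162))
    (hK : K.IsFull (144 * g - 162) 10 N part)
    {V : Type*} [Finite V] (G : OrientedGraph V) (hG : G.underlying.eulerGenus ≤ g) :
    ∃ H : OrientedGraph W,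
      (K.deleteEdgesInLast part (6 * g)).IsSpanningSubgraph H ∧ ∃ φ : V → W, G.IsHom H φ := by
  have := Fintype.ofFinite V
  obtain ⟨φ, hφ⟩ := OrientedGraph.exists_isPartialHom hg hK hG Finset.univ (by simp)
  -- `K` loses its edges inside the last partite sets, and gains there the images of edges of `G`
  refine ⟨{ Adj := fun a b => (K.deleteEdgesInLast part (6 * g)).Adj a b ∨
              (144 * g - 162 ≤ (part a : ℕ) + 6 * g ∧ 144 * g - 162 ≤ (part b : ℕ) + 6 * g) ∧
                ∃ u v, G.Adj u v ∧ φ u = a ∧ φ v = b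
            asymm := ?_ }, fun a b h => Or.inl h, φ, ?_⟩
  · rintro a b (h | ⟨h, u, v, huv, rfl, rfl⟩) (h' | ⟨h', u', v', huv', hu', hv'⟩)
    · exact OrientedGraph.asymm _ a b h h'
    · exact h.2 h'.symm
    · exact h'.2 h.symm
    · have h1 := hφ.injOn_last u' (Finset.mem_univ _) v (Finset.mem_univ _) (hu' ▸ h.2)
        (congrArg part hu')
      have h2 := hφ.injOn_last v' (Finset.mem_univ _) u (Finset.mem_univ _) (hv' ▸ h.1)
        (congrArg part hv')
      subst h1 h2
      exact G.asymm _ _ huv huv'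
  · intro u v huv
    by_cases hlast : 144 * g - 162 ≤ (part (φ u) : ℕ) + 6 * g ∧
        144 * g - 162 ≤ (part (φ v) : ℕ) + 6 * g
    · exact Or.inr ⟨hlast, u, v, huv, rfl, rfl⟩
    · rcases hφ.adj u (Finset.mem_univ _) v (Finset.mem_univ _) huv with h | h
      · exact absurd h hlast
      · exact Or.inl ⟨h, hlast⟩
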